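/- Let $n\ge 4$. For a partition $\lambda=(\lambda_1\ge\dots\ge\lambda_n\ge 0)$ with at most $n$ parts let $|\lambda|=\sum_i\lambda_i$ and let $$s_\lambda=\frac{\det\big(x_i^{\lambda_j+n-j}\big)_{1\le i,j\le n}}{\det\big(x_i^{n-j}\big)_{1\le i,j\le n}}$$ be the Schur polynomial in $x_1,\dots,x_n$ (the character of the irreducible representation $V_n(\lambda)$ of $\mathrm{GL}_n(\mathbb C)$). The Littlewood–Richardson coefficients $c_{\lambda\mu}^{\nu}$ are defined by $s_\lambda s_\mu=\sum_\nu c_{\lambda\mu}^\nu s_\nu$, the sum being over the partitions $\nu$ with at most $n$ parts; that is, $c_{\lambda\mu}^\nu$ is the multiplicity of $V_n(\nu)$ in $V_n(\lambda)\otimes V_n(\mu)$. Let $\lambda=(\lambda_1,\lambda_2^{n-2},0)$ and $\mu=(\mu_1,\mu_2^{n-2},0)$ be partitions, where exponents denote repetition, and let $\nu$ be a partition with at most $n$ parts. Then: 1. $c_{\lambda\mu}^\nu=0$ unless $|\nu|=|\lambda|+|\mu|$ and $\nu=(\nu_1,\nu_2,(\lambda_2+\mu_2)^{n-4},\nu_{n-1},\nu_n)$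 for integers $\nu_1\ge\nu_2\ge\lambda_2+\mu_2\ge\nu_{n-1}\ge\nu_n\ge 0$. 2. If $\nu$ has this form and $|\nu|=|\lambda|+|\mu|$, then $c_{\lambda\mu}^\nu$ is the number of integers $a$ with $M\le a\le m$, where $$M=\max(0,\ \lambda_2+\mu_1-\nu_1,\ -\mu_2+\nu_n),$$ $$m=\min(\lambda_1+\mu_1-\nu_1,\ \lambda_2+\mu_1-\nu_2,\ -\lambda_2-\mu_2+\nu_{n-1}+\nu_n,\ -\mu_2+\nu_{n-1}).$$ 3. In particular the value does not depend on $n\ge 4$: if $\nu$ has the form in 1, then $c_{\lambda\mu}^\nu$ equals the coefficient $c_{\lambda'\mu'}^{\nu'}$ for $n=4$, where $\lambda'=(\lambda_1,\lambda_2,\lambda_2,0)$, $\mu'=(\mu_1,\mu_2,\mu_2,0)$ and $\nu'=(\nu_1,\nu_2,\nu_{n-1},\nu_n)$. -/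

import Mathlib

/-- `Λₙ`: the partitions with at most `n` parts, as weakly decreasing sequences `ν₁ ≥ ⋯ ≥ νₙ ≥ 0`
(the index `i : Fin n` holds the part `ν_{i+1}`). -/
abbrev PartitionsLE (n : ℕ) : Type := {p : Fin n → ℕ // Antitone p}

/-- The size `|ν|` of a partition. -/
def PartitionsLE.size {n : ℕ} (p : PartitionsLE n) : ℕ := ∑ i, p.1 i

/-- The alternant `a_{p+δ} = det (x_i ^ (p_j + n - j))_{1 ≤ i, j ≤ n}`, with
`δ = (n - 1, n - 2, …, 0)`. -/
noncomputable def alternant {n : ℕ} (p : Fin n → ℕ) : MvPolynomial (Fin n) ℤ :=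
  (Matrix.of fun i j : Fin n =>
    (MvPolynomial.X i : MvPolynomial (Fin n) ℤ) ^ (p j + (Fin.rev j : ℕ))).det

/-- The Schur polynomial `s_p(x₁, …, xₙ) = a_{p+δ} / a_δ`, that is, the character of the
irreducible representation `V_n(p)` of `GL_n(ℂ)`, regarded as an element of the field of rational
functions. -/
noncomputable def schur {n : ℕ} (p : PartitionsLE n) :
    FractionRing (MvPolynomial (Fin n) ℤ) :=
  algebraMap (MvPolynomial (Fin n) ℤ) (FractionRing (MvPolynomial (Fin n) ℤ)) (alternant p.1) /
    algebraMap (MvPolynomial (Fin n) ℤ) (FractionRing (MvPolynomial (Fin n) ℤ))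
      (alternant (0 : Fin n → ℕ))

/-- `c` is the family of coefficients of `s_p * s_q` in the Schur polynomials:
`s_p * s_q = ∑_r c_r * s_r` (a finite sum over the partitions with at most `n` parts). -/
def IsSchurExpansion {n : ℕ} (p q : PartitionsLE n) (c : PartitionsLE n →₀ ℤ) : Prop :=
  schur p * schur q =
    c.sum fun r m => (m : FractionRing (MvPolynomial (Fin n) ℤ)) * schur r

/-- The coefficient of `x^{q+δ}` in `a_{p+δ}` is `1` if `p = q` and `0` otherwise. -/
theorem coeff_alternant {n : ℕ} (p q : PartitionsLE n) :
    MvPolynomial.coeff (Finsupp.equivFunOnFinite.symm fun i => q.1 i + (Fin.rev i : ℕ))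
      (alternant p.1) = if p = q then 1 else 0 := by
  classical
  have hanti : ∀ r : PartitionsLE n, StrictAnti fun i => r.1 i + (Fin.rev i : ℕ) := by
    intro r i j hij
    have h1 := r.2 hij.le
    have h2 : (Fin.rev j : ℕ) < (Fin.rev i : ℕ) := Fin.rev_lt_rev.mpr hij
    exact add_lt_add_of_le_of_lt h1 h2
  have hprod : ∀ σ : Equiv.Perm (Fin n),
      ∏ i, (MvPolynomial.X (σ i) : MvPolynomial (Fin n) ℤ) ^ (p.1 i + (Fin.rev i : ℕ)) =
        MvPolynomial.monomial (Finsupp.equivFunOnFinite.symm fun i =>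
          p.1 (σ⁻¹ i) + (Fin.rev (σ⁻¹ i) : ℕ)) 1 := by
    intro σ
    rw [MvPolynomial.monomial_eq, Finsupp.prod_fintype _ _ (by simp), map_one, one_mul]
    refine Fintype.prod_equiv σ _ _ fun i => ?_
    simp
  have key : ∀ σ : Equiv.Perm (Fin n),
      ((Finsupp.equivFunOnFinite.symm fun i => p.1 (σ⁻¹ i) + (Fin.rev (σ⁻¹ i) : ℕ)) =
        Finsupp.equivFunOnFinite.symm fun i => q.1 i + (Fin.rev i : ℕ)) → σ = 1 := by
    intro σ h
    have h' := Finsupp.equivFunOnFinite.symm.injective h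
    have hs : StrictMono (σ⁻¹ : Equiv.Perm (Fin n)) := by
      intro i j hij
      have hq := hanti q hij
      simp only [← congrFun h' i, ← congrFun h' j] at hq
      exact (hanti p).lt_iff_gt.mp hq
    have hid : (σ⁻¹ : Equiv.Perm (Fin n)) = 1 := by
      have := Subsingleton.elim
        (hs.orderIsoOfSurjective _ (σ⁻¹ : Equiv.Perm (Fin n)).surjective) (OrderIso.refl _)
      ext i
      exact congrArg Fin.val (congrArg (fun e : Fin n ≃o Fin n => e i) this)
    exact inv_eq_one.mp hid
  unfold alternant
  rw [Matrix.det_apply', MvPolynomial.coeff_sum, Finset.sum_eq_single 1]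
  · simp only [Matrix.of_apply]
    rw [hprod 1]
    simp only [Equiv.Perm.sign_one, Units.val_one, Int.cast_one, one_mul, inv_one,
      Equiv.Perm.coe_one, id_eq, MvPolynomial.coeff_monomial]
    refine if_congr ⟨fun h => ?_, fun h => by rw [h]⟩ rfl rfl
    have h' := Finsupp.equivFunOnFinite.symm.injective h
    ext i
    simpa using congrFun h' i
  · intro σ _ hσ
    simp only [Matrix.of_apply]
    rw [hprod σ, ← map_intCast (MvPolynomial.C : ℤ →+* MvPolynomial (Fin n) ℤ),
      MvPolynomial.coeff_C_mul, MvPolynomial.coeff_monomial, if_neg fun h => hσ (key σ h), mul_zero]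
  · simp

/-- The denominator of the Schur polynomials is nonzero. -/
theorem alternant_zero_ne_zero (n : ℕ) : alternant (0 : Fin n → ℕ) ≠ 0 := by
  intro h
  have := coeff_alternant (⟨0, antitone_const⟩ : PartitionsLE n) ⟨0, antitone_const⟩
  simp [h] at this

/-- The coefficients of an expansion in Schur polynomials are unique. -/
theorem IsSchurExpansion.unique {n : ℕ} {p q : PartitionsLE n} {c d : PartitionsLE n →₀ ℤ}
    (hc : IsSchurExpansion p q c) (hd : IsSchurExpansion p q d) : c = d := by
  classical
  have hne : algebraMap (MvPolynomial (Fin n) ℤ) (FractionRing (MvPolynomial (Fin n) ℤ))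
      (alternant (0 : Fin n → ℕ)) ≠ 0 := by
    rw [Ne, FaithfulSMul.algebraMap_eq_zero_iff]
    exact alternant_zero_ne_zero n
  have hmul : ∀ e : PartitionsLE n →₀ ℤ, IsSchurExpansion p q e →
      schur p * schur q * algebraMap (MvPolynomial (Fin n) ℤ) _ (alternant (0 : Fin n → ℕ)) =
        algebraMap (MvPolynomial (Fin n) ℤ) _
          (e.sum fun r m => MvPolynomial.C m * alternant r.1) := by
    intro e he
    rw [he, Finsupp.sum, Finsupp.sum, Finset.sum_mul, map_sum]
    refine Finset.sum_congr rfl fun r _ => ?_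
    rw [schur, mul_assoc, div_mul_cancel₀ _ hne, map_mul]
    simp
  have heq := FaithfulSMul.algebraMap_injective (MvPolynomial (Fin n) ℤ)
    (FractionRing (MvPolynomial (Fin n) ℤ)) ((hmul c hc).symm.trans (hmul d hd))
  have hcoeff : ∀ (e : PartitionsLE n →₀ ℤ) (r : PartitionsLE n),
      MvPolynomial.coeff (Finsupp.equivFunOnFinite.symm fun i => r.1 i + (Fin.rev i : ℕ))
        (e.sum fun r m => MvPolynomial.C m * alternant r.1) = e r := by
    intro e r
    rw [Finsupp.sum, MvPolynomial.coeff_sum]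
    simp only [MvPolynomial.coeff_C_mul, coeff_alternant, mul_ite, mul_one, mul_zero]
    rw [Finset.sum_ite_eq']
    simp +contextual [eq_comm]
  ext r
  rw [← hcoeff c r, heq, hcoeff d r]

open Classical in
/-- The Littlewood-Richardson coefficient `c_{pq}^r`: the coefficient of `s_r` in the expansion of
`s_p * s_q` in Schur polynomials in `n` variables, equivalently the multiplicity of `V_n(r)` in
`V_n(p) ⊗ V_n(q)`.  The expansion is unique by `IsSchurExpansion.unique`. -/
noncomputable def lrCoeff {n : ℕ} (p q r : PartitionsLE n) : ℤ :=
  if h : ∃ c : PartitionsLE n →₀ ℤ, IsSchurExpansion p q c then h.choose r else 0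

/-- The sequence `a b^{n-2} z` of length `n`. -/
def nearRect (n a b z : ℕ) : Fin n → ℕ := fun i =>
  if (i : ℕ) = 0 then a else if (i : ℕ) = n - 1 then z else b

/-- The sequence `a b s^{n-4} y z` of length `n`. -/
def nearRectTwo (n a b s y z : ℕ) : Fin n → ℕ := fun i =>
  if (i : ℕ) = 0 then a else if (i : ℕ) = 1 then b
  else if (i : ℕ) = n - 1 then z else if (i : ℕ) = n - 2 then y else s

/-! Write λ = (p+q, q^{n-2}, 0). Up to the factor (x₁⋯xₙ)^q, s_λ is the character of highest weight
(p, 0, …, 0, -q), namely h_p(x) h_q(x⁻¹) - h_{p-1}(x) h_{q-1}(x⁻¹). Pieri's rule in x⁻¹ and then in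
x expands h_p(x) h_q(x⁻¹) times an alternant over pairs (α, β): remove a horizontal strip α of size
q, then add a horizontal strip β of size p. Since exponents are integers, interlacing puts no upper
bound on αₙ. Lowering αₙ and βₙ by 1 matches the pairs with both positive to the pairs for (p-1,
q-1), so the subtraction leaves exactly the pairs with αₙ = 0 or βₙ = 0
(`mixedComplete_mul_zAlternant`). Applied to a_δ this proves the character formula
(`schur_nearRect`); applied to a_{μ+δ} it makes the coefficient a number of pairs, for every μ
(`lrCoeff_nearRect`).

If μ is also a near-rectangle, its constant middle forces α_i = 0 for 2 ≤ i ≤ n-2, which gives the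
shape of ν. Given ν, α determines β, the condition at n determines αₙ, and |α| = q leaves the single
parameter a = α₁. The remaining inequalities say that a lies in [M, m] (`card_filter_reducedPairs`),
and n does not occur in them. -/

/-- The generalized alternant `det (x_i ^ e_j)` with integer exponents. -/
noncomputable def zAlternant {K : Type*} [Field K] {n : ℕ} (x : Fin n → K) (e : Fin n → ℤ) : K :=
  (Matrix.of fun i j : Fin n => x i ^ e j).det

/-- The complete homogeneous symmetric sum of degree `k` in the `x i`. -/
noncomputable def completeSum {K : Type*} [Field K] {n : ℕ} (x : Fin n → K) (k : ℕ) : K :=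
  ∑ α ∈ Finset.piAntidiag (Finset.univ : Finset (Fin n)) k, ∏ i, x i ^ α i

/-! ### Alternants with integer exponents -/

section Alternant

variable {K : Type*} [Field K] {n : ℕ}

theorem zAlternant_comp_perm (x : Fin n → K) (e : Fin n → ℤ) (σ : Equiv.Perm (Fin n)) :
    zAlternant x (e ∘ σ) = (Equiv.Perm.sign σ : ℤ) * zAlternant x e := by
  rw [zAlternant, zAlternant, ← Matrix.det_permute']
  rfl

theorem zAlternant_comp_swap (x : Fin n → K) (e : Fin n → ℤ) {i j : Fin n} (hij : i ≠ j) :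
    zAlternant x (e ∘ Equiv.swap i j) = -zAlternant x e := by
  rw [zAlternant_comp_perm, Equiv.Perm.sign_swap hij]
  simp

theorem zAlternant_eq_zero (x : Fin n → K) (e : Fin n → ℤ) {i j : Fin n} (hij : i ≠ j)
    (h : e i = e j) : zAlternant x e = 0 :=
  Matrix.det_zero_of_column_eq hij fun k => by simp [h]

theorem zAlternant_inv (x : Fin n → K) (e : Fin n → ℤ) :
    zAlternant (fun i => (x i)⁻¹) e = zAlternant x fun i => -e i := by
  simp only [zAlternant, inv_zpow']

theorem zAlternant_add_const {x : Fin n → K} (hx : ∀ i, x i ≠ 0) (e : Fin n → ℤ) (c : ℤ) :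
    zAlternant x (fun i => e i + c) = (∏ i, x i ^ c) * zAlternant x e := by
  rw [zAlternant, zAlternant, ← Matrix.det_mul_column]
  congr 1
  ext i j
  simp [zpow_add₀ (hx i), mul_comm]

/-- The complete sum is symmetric, so in the determinant term of σ each α may be replaced by α ∘ σ;
the exponents then add column by column. -/
theorem completeSum_mul_zAlternant {x : Fin n → K} (hx : ∀ i, x i ≠ 0) (e : Fin n → ℤ) (k : ℕ) :
    completeSum x k * zAlternant x e =
      ∑ α ∈ Finset.piAntidiag (Finset.univ : Finset (Fin n)) k,
        zAlternant x fun i => e i + α i := by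
  simp only [completeSum, zAlternant, Matrix.det_apply', Matrix.of_apply]
  rw [Finset.mul_sum, Finset.sum_comm]
  refine Finset.sum_congr rfl fun σ _ => ?_
  rw [Finset.sum_mul]
  refine Finset.sum_bij' (fun α _ => α ∘ σ) (fun α _ => α ∘ σ.symm) ?_ ?_ ?_ ?_ ?_
  · intro α hα
    simpa [Finset.mem_piAntidiag, Equiv.sum_comp σ α] using hα
  · intro α hα
    simpa [Finset.mem_piAntidiag, Equiv.sum_comp σ.symm α] using hα
  · intro α _
    ext i
    simp
  · intro α _
    ext i
    simp
  · intro α _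
    rw [← Equiv.prod_comp σ fun i => x i ^ α i, mul_left_comm, ← Finset.prod_mul_distrib]
    congr 1
    refine Finset.prod_congr rfl fun i _ => ?_
    rw [add_comm, zpow_add₀ (hx _), zpow_natCast]
    rfl

end Alternant

/-! ### Pieri's rule by a sign-reversing involution -/

/-- For an alternating function `F`, the sum of the `F (e + α)` over all `α` of size `k` reduces to
the `α` for which `e + α` interlaces with `e`. -/
theorem sum_piAntidiag_add_eq_sum_filter {M : Type*} [AddCommGroup M] {n : ℕ}
    {F : (Fin (n + 1) → ℤ) → M}
    (hswap : ∀ e i j, i ≠ j → F (e ∘ Equiv.swap i j) = -F e)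
    (hzero : ∀ e i j, i ≠ j → e i = e j → F e = 0)
    {e : Fin (n + 1) → ℤ} (he : StrictAnti e) (k : ℕ) :
    ∑ α ∈ Finset.piAntidiag (Finset.univ : Finset (Fin (n + 1))) k, F (fun i => e i + α i) =
      ∑ α ∈ (Finset.piAntidiag (Finset.univ : Finset (Fin (n + 1))) k).filter
        (fun α => ∀ i j, i < j → e j + α j < e i), F (fun i => e i + α i) := by
  classical
  rw [← Finset.sum_filter_add_sum_filter_not _ (fun α => ∀ i j, i < j → e j + α j < e i)]
  conv_rhs => rw [← add_zero (Finset.sum _ _)]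
  congr 1
  -- `B α` is the set of adjacent places where interlacing fails; as e decreases, adjacent places
  -- suffice.
  let B : (Fin (n + 1) → ℕ) → Finset (Fin n) := fun α =>
    Finset.univ.filter fun i => e i.castSucc ≤ e i.succ + α i.succ
  have hB : ∀ α i, i ∈ B α ↔ e i.castSucc ≤ e i.succ + α i.succ := by simp [B]
  have hne : ∀ α : Fin (n + 1) → ℕ, (¬ ∀ i j, i < j → e j + α j < e i) ↔ (B α).Nonempty := by
    intro α
    rw [← not_iff_not, not_not, Finset.not_nonempty_iff_eq_empty, Finset.eq_empty_iff_forall_notMem]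
    constructor
    · intro h i hi
      exact absurd ((hB _ _).1 hi) (not_le.2 (h _ _ i.castSucc_lt_succ))
    · intro h i j hij
      obtain ⟨c, rfl⟩ := Fin.exists_succ_eq.2 (Fin.ne_zero_of_lt hij)
      have h1 := h c
      rw [hB, not_le] at h1
      exact h1.trans_le (he.antitone (Fin.le_castSucc_iff.2 hij))
  -- `R i α` is the α' for which e + α' is e + α with its entries at i and i+1 exchanged. At a
  -- failure i no entry of α' is negative, so `toNat` loses nothing.
  let R : Fin n → (Fin (n + 1) → ℕ) → Fin (n + 1) → ℕ := fun i α t =>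
    (e (Equiv.swap i.castSucc i.succ t) + α (Equiv.swap i.castSucc i.succ t) - e t).toNat
  have hR : ∀ i α, i ∈ B α → ∀ t, (R i α t : ℤ) =
      e (Equiv.swap i.castSucc i.succ t) + α (Equiv.swap i.castSucc i.succ t) - e t := by
    intro i α hi t
    have h1 := (hB _ _).1 hi
    have h2 := he i.castSucc_lt_succ
    refine Int.toNat_of_nonneg ?_
    rcases eq_or_ne t i.castSucc with rfl | ht
    · rw [Equiv.swap_apply_left]
      omega
    rcases eq_or_ne t i.succ with rfl | ht'
    · rw [Equiv.swap_apply_right]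
      omega
    · rw [Equiv.swap_apply_of_ne_of_ne ht ht']
      omega
  have hRF : ∀ i α, i ∈ B α → (fun t => e t + R i α t) =
      (fun t => e t + (α t : ℤ)) ∘ Equiv.swap i.castSucc i.succ := by
    intro i α hi
    ext t
    simp [hR i α hi t]
  have hRB : ∀ i α, i ∈ B α → i ∈ B (R i α) := by
    intro i α hi
    rw [hB, hR i α hi, Equiv.swap_apply_right]
    have h2 := he i.castSucc_lt_succ
    omega
  have hRB' : ∀ i α, i ∈ B α → ∀ j, i < j → (j ∈ B (R i α) ↔ j ∈ B α) := by
    intro i α hi j hij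
    rw [hB, hB, hR i α hi, Equiv.swap_apply_of_ne_of_ne]
    · simp
    · exact (Fin.castSucc_lt_succ.trans (Fin.succ_lt_succ_iff.2 hij)).ne'
    · exact (Fin.succ_lt_succ_iff.2 hij).ne'
  -- Exchanging at the last failure keeps it the last failure, so the map is an involution.
  have hmax : ∀ α (h : (B α).Nonempty) (h' : (B (R ((B α).max' h) α)).Nonempty),
      (B (R ((B α).max' h) α)).max' h' = (B α).max' h := by
    intro α h h'
    have hm := Finset.max'_mem _ h
    refine le_antisymm (Finset.max'_le _ _ _ fun j hj => ?_) (Finset.le_max' _ _ (hRB _ _ hm))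
    by_contra! hlt
    exact absurd (Finset.le_max' _ _ ((hRB' _ _ hm j hlt).1 hj)) (not_le.2 hlt)
  have hRR : ∀ i α, i ∈ B α → R i (R i α) = α := by
    intro i α hi
    ext t
    zify
    rw [hR i _ (hRB i α hi), hR i α hi]
    simp
  have hmem : ∀ {α}, α ∈ (Finset.piAntidiag (Finset.univ : Finset (Fin (n + 1))) k).filter
      (fun α => ¬ ∀ i j, i < j → e j + α j < e i) ↔ ∑ i, α i = k ∧ (B α).Nonempty := by
    intro α
    rw [Finset.mem_filter, hne, Finset.mem_piAntidiag]
    simp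
  refine Finset.sum_involution (fun α hα => R ((B α).max' (hmem.1 hα).2) α) ?_ ?_ ?_ ?_
  · intro α hα
    have hi := Finset.max'_mem _ (hmem.1 hα).2
    rw [hRF _ _ hi, hswap _ _ _ Fin.castSucc_lt_succ.ne, add_neg_cancel]
  -- At a fixed point e + α has two equal entries, so F vanishes there; alternation alone would only
  -- give 2F = 0.
  · intro α hα hF heq
    have hi := Finset.max'_mem _ (hmem.1 hα).2
    refine hF (hzero _ _ _ (Fin.castSucc_lt_succ (i := (B α).max' (hmem.1 hα).2)).ne ?_)
    have := congrFun (hRF _ _ hi) ((B α).max' (hmem.1 hα).2).castSucc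
    simpa [heq] using this
  · intro α hα
    have hi := Finset.max'_mem _ (hmem.1 hα).2
    refine hmem.2 ⟨?_, _, hRB _ _ hi⟩
    refine Eq.trans ?_ (hmem.1 hα).1
    zify
    rw [Finset.sum_congr rfl fun t _ => hR _ _ hi t, Finset.sum_sub_distrib,
      Equiv.sum_comp (Equiv.swap _ _) fun t => e t + (α t : ℤ), Finset.sum_add_distrib]
    ring
  · intro α hα
    have hi := Finset.max'_mem _ (hmem.1 hα).2
    simp only [hmax]
    exact hRR _ _ hi

section Pieri

variable {K : Type*} [Field K] {n : ℕ}

/-- Pieri's rule for alternants. -/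
theorem completeSum_mul_zAlternant_of_strictAnti {x : Fin (n + 1) → K} (hx : ∀ i, x i ≠ 0)
    {e : Fin (n + 1) → ℤ} (he : StrictAnti e) (k : ℕ) :
    completeSum x k * zAlternant x e =
      ∑ α ∈ (Finset.piAntidiag (Finset.univ : Finset (Fin (n + 1))) k).filter
        (fun α => ∀ i j, i < j → e j + α j < e i), zAlternant x fun i => e i + α i := by
  rw [completeSum_mul_zAlternant hx]
  exact sum_piAntidiag_add_eq_sum_filter (fun e _ _ h => zAlternant_comp_swap x e h)
    (fun e _ _ h h' => zAlternant_eq_zero x e h h') he k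

/-- Pieri's rule for alternants and the inverse variables. -/
theorem completeSum_inv_mul_zAlternant_of_strictAnti {x : Fin (n + 1) → K} (hx : ∀ i, x i ≠ 0)
    {e : Fin (n + 1) → ℤ} (he : StrictAnti e) (k : ℕ) :
    completeSum (fun i => (x i)⁻¹) k * zAlternant x e =
      ∑ α ∈ (Finset.piAntidiag (Finset.univ : Finset (Fin (n + 1))) k).filter
        (fun α => ∀ i j, i < j → e j < e i - α i), zAlternant x fun i => e i - α i := by
  have h1 : zAlternant x e = zAlternant (fun i => (x i)⁻¹) fun i => -e i := by
    simp [zAlternant_inv]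
  have he' : StrictAnti fun i : Fin (n + 1) => -e (Fin.rev i) := fun i j hij =>
    neg_lt_neg (he (Fin.rev_lt_rev.2 hij))
  -- Negating and reversing the exponents turns removal of a strip into addition while keeping the
  -- sequence decreasing.
  have h2 := sum_piAntidiag_add_eq_sum_filter (F := fun e => zAlternant x fun i => -e (Fin.rev i))
    (fun e i j h => by
      rw [← zAlternant_comp_swap x _ (Fin.rev_injective.ne h)]
      congr 1
      ext t
      simp only [Function.comp_apply, Equiv.swap_apply_def]
      grind [Fin.rev_rev])
    (fun e i j h h' => zAlternant_eq_zero x _ (Fin.rev_injective.ne h) (by simp [h'])) he' k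
  have hmem : ∀ α : Fin (n + 1) → ℕ,
      α ∘ Fin.rev ∈ Finset.piAntidiag (Finset.univ : Finset (Fin (n + 1))) k ↔
        α ∈ Finset.piAntidiag (Finset.univ : Finset (Fin (n + 1))) k := by
    intro α
    simp [Finset.mem_piAntidiag,
      show ∑ i, α (Fin.rev i) = ∑ i, α i from Equiv.sum_comp Fin.revPerm α]
  have hrev : ∀ α : Fin (n + 1) → ℕ, (α ∘ Fin.rev) ∘ Fin.rev = α := fun α => by
    ext i
    simp
  rw [h1, completeSum_mul_zAlternant fun i => inv_ne_zero (hx i)]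
  simp only [zAlternant_inv]
  refine Eq.trans ?_ (h2.trans ?_)
  · refine Finset.sum_bij' (fun α _ => α ∘ Fin.rev) (fun α _ => α ∘ Fin.rev)
      (fun α h => (hmem α).2 h) (fun α h => (hmem α).2 h) (fun α _ => hrev α) (fun α _ => hrev α) ?_
    intro α _
    simp
  · refine Finset.sum_bij' (fun α _ => α ∘ Fin.rev) (fun α _ => α ∘ Fin.rev) ?_ ?_
      (fun α _ => hrev α) (fun α _ => hrev α) ?_
    · intro α h
      rw [Finset.mem_filter] at h ⊢
      refine ⟨(hmem α).2 h.1, fun i j hij => ?_⟩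
      have := h.2 _ _ (Fin.rev_lt_rev.2 hij)
      simp only [Fin.rev_rev] at this
      simp only [Function.comp_apply]
      omega
    · intro α h
      rw [Finset.mem_filter] at h ⊢
      refine ⟨(hmem α).2 h.1, fun i j hij => ?_⟩
      have := h.2 _ _ (Fin.rev_lt_rev.2 hij)
      simp only [Function.comp_apply] at this ⊢
      omega
    · intro α _
      congr 1
      ext i
      simp [sub_eq_add_neg, add_comm]

end Pieri

/-! ### Removing a strip, then adding one -/

/-- The pairs `(α, β)` of sizes `q` and `p` such that `e - α` interlaces with `e`, and `e - α + β`
with `e - α`. -/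
def pieriPairs {n : ℕ} (e : Fin n → ℤ) (p q : ℕ) : Finset ((Fin n → ℕ) × (Fin n → ℕ)) :=
  (Finset.piAntidiag Finset.univ q ×ˢ Finset.piAntidiag Finset.univ p).filter fun w =>
    ∀ i j, i < j → e j < e i - w.1 i ∧ e j - w.1 j + w.2 j < e i - w.1 i

theorem mem_pieriPairs {n : ℕ} {e : Fin n → ℤ} {p q : ℕ} {w : (Fin n → ℕ) × (Fin n → ℕ)} :
    w ∈ pieriPairs e p q ↔ (∑ i, w.1 i = q ∧ ∑ i, w.2 i = p) ∧
      ∀ i j, i < j → e j < e i - w.1 i ∧ e j - w.1 j + w.2 j < e i - w.1 i := by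
  simp [pieriPairs, Finset.mem_piAntidiag]

/-- The pairs in `pieriPairs` with `α` or `β` vanishing at the last index. -/
def reducedPairs {n : ℕ} (e : Fin (n + 1) → ℤ) (p q : ℕ) :
    Finset ((Fin (n + 1) → ℕ) × (Fin (n + 1) → ℕ)) :=
  (pieriPairs e p q).filter fun w => w.1 (Fin.last n) = 0 ∨ w.2 (Fin.last n) = 0

/-- The symmetric rational function `h_p(x) h_q(x⁻¹) - h_{p-1}(x) h_{q-1}(x⁻¹)`, the character of
the irreducible representation with highest weight `(p, 0, …, 0, -q)`. -/
noncomputable def mixedComplete {K : Type*} [Field K] {n : ℕ} (x : Fin n → K) (p q : ℕ) : K :=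
  completeSum x p * completeSum (fun i => (x i)⁻¹) q -
    if p = 0 ∨ q = 0 then 0 else completeSum x (p - 1) * completeSum (fun i => (x i)⁻¹) (q - 1)

section

variable {K : Type*} [Field K] {n : ℕ}

theorem completeSum_mul_completeSum_inv_mul_zAlternant {x : Fin (n + 1) → K} (hx : ∀ i, x i ≠ 0)
    {e : Fin (n + 1) → ℤ} (he : StrictAnti e) (p q : ℕ) :
    completeSum x p * completeSum (fun i => (x i)⁻¹) q * zAlternant x e =
      ∑ w ∈ pieriPairs e p q, zAlternant x fun i => e i - w.1 i + w.2 i := by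
  rw [mul_assoc, completeSum_inv_mul_zAlternant_of_strictAnti hx he, Finset.mul_sum]
  rw [Finset.sum_finset_product (pieriPairs e p q)
    ((Finset.piAntidiag Finset.univ q).filter fun α => ∀ i j, i < j → e j < e i - α i)
    fun α => (Finset.piAntidiag Finset.univ p).filter
      fun β => ∀ i j, i < j → e j - α j + β j < e i - α i]
  · refine Finset.sum_congr rfl fun α hα => completeSum_mul_zAlternant_of_strictAnti hx ?_ p
    intro i j hij
    have := (Finset.mem_filter.1 hα).2 i j hij
    show e j - α j < e i - α i
    omega
  · intro w
    simp only [mem_pieriPairs, Finset.mem_filter, Finset.mem_piAntidiag]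
    grind

/-- The subtracted product cancels the pairs with both last entries nonzero. The inequalities
involve the last entries only through β - α, so both can be shifted by 1 freely. -/
theorem mixedComplete_mul_zAlternant {x : Fin (n + 1) → K} (hx : ∀ i, x i ≠ 0)
    {e : Fin (n + 1) → ℤ} (he : StrictAnti e) (p q : ℕ) :
    mixedComplete x p q * zAlternant x e =
      ∑ w ∈ reducedPairs e p q, zAlternant x fun i => e i - w.1 i + w.2 i := by
  rw [mixedComplete, sub_mul, completeSum_mul_completeSum_inv_mul_zAlternant hx he, sub_eq_iff_eq_add,
    reducedPairs, ← Finset.sum_filter_add_sum_filter_not (pieriPairs e p q)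
      fun w => w.1 (Fin.last n) = 0 ∨ w.2 (Fin.last n) = 0]
  congr 1
  split_ifs with h
  · rw [zero_mul, Finset.filter_eq_empty_iff.2, Finset.sum_empty]
    intro w hw
    rw [not_not]
    obtain ⟨⟨h1, h2⟩, -⟩ := mem_pieriPairs.1 hw
    rcases h with rfl | rfl
    · exact Or.inr (Finset.sum_eq_zero_iff.1 h2 _ (Finset.mem_univ _))
    · exact Or.inl (Finset.sum_eq_zero_iff.1 h1 _ (Finset.mem_univ _))
  · rw [completeSum_mul_completeSum_inv_mul_zAlternant hx he]
    have hsub : ∀ α : Fin (n + 1) → ℕ, α (Fin.last n) ≠ 0 →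
        α - Pi.single (Fin.last n) 1 + Pi.single (Fin.last n) 1 = α := by
      intro α hα
      refine tsub_add_cancel_of_le fun i => ?_
      rcases eq_or_ne i (Fin.last n) with rfl | hi
      · simpa using Nat.one_le_iff_ne_zero.2 hα
      · simp [hi]
    have hval : ∀ α : Fin (n + 1) → ℕ, α (Fin.last n) ≠ 0 → ∀ i, (α i : ℤ) =
        (α - Pi.single (Fin.last n) 1 : Fin (n + 1) → ℕ) i +
          (Pi.single (Fin.last n) 1 : Fin (n + 1) → ℕ) i := by
      intro α hα i
      exact_mod_cast congrFun (hsub α hα).symm i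
    have hsum : ∀ α : Fin (n + 1) → ℕ, α (Fin.last n) ≠ 0 →
        ∑ i, α i = ∑ i, (α - Pi.single (Fin.last n) 1 : Fin (n + 1) → ℕ) i + 1 := by
      intro α hα
      conv_lhs => rw [← hsub α hα]
      simp [Finset.sum_add_distrib]
    have hlt : ∀ i j : Fin (n + 1), i < j → (Pi.single (Fin.last n) 1 : Fin (n + 1) → ℕ) i = 0 :=
      fun i j hij => Pi.single_eq_of_ne (hij.trans_le (Fin.le_last j)).ne _
    refine Finset.sum_bij'
      (fun w _ => (w.1 - Pi.single (Fin.last n) 1, w.2 - Pi.single (Fin.last n) 1))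
      (fun w _ => (w.1 + Pi.single (Fin.last n) 1, w.2 + Pi.single (Fin.last n) 1)) ?_ ?_ ?_ ?_ ?_
    · intro w hw
      rw [Finset.mem_filter, not_or, mem_pieriPairs] at hw
      obtain ⟨⟨⟨h1, h2⟩, h3⟩, h4, h5⟩ := hw
      rw [hsum _ h4] at h1
      rw [hsum _ h5] at h2
      refine mem_pieriPairs.2 ⟨⟨by simp only; omega, by simp only; omega⟩, fun i j hij => ?_⟩
      have := h3 i j hij
      rw [hval _ h4 i, hval _ h4 j, hval _ h5 j, hlt i j hij] at this
      simp only
      omega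
    · intro w hw
      obtain ⟨⟨h1, h2⟩, h3⟩ := mem_pieriPairs.1 hw
      rw [Finset.mem_filter, mem_pieriPairs]
      refine ⟨⟨⟨?_, ?_⟩, fun i j hij => ?_⟩, by simp⟩
      · simp only [Pi.add_apply, Finset.sum_add_distrib, h1, Finset.sum_pi_single',
          Finset.mem_univ, if_true]
        omega
      · simp only [Pi.add_apply, Finset.sum_add_distrib, h2, Finset.sum_pi_single',
          Finset.mem_univ, if_true]
        omega
      · have := h3 i j hij
        simp only [Pi.add_apply, hlt i j hij]
        push_cast
        omega
    · intro w hw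
      rw [Finset.mem_filter, not_or] at hw
      exact Prod.ext (hsub _ hw.2.1) (hsub _ hw.2.2)
    · intro w hw
      simp
    · intro w hw
      rw [Finset.mem_filter, not_or] at hw
      congr 1
      ext i
      rw [hval _ hw.2.1 i, hval _ hw.2.2 i]
      ring

end

theorem eq_piSingle_of_forall_ne {n : ℕ} {α : Fin n → ℕ} (i : Fin n) (h : ∀ j, j ≠ i → α j = 0) :
    α = Pi.single i (∑ j, α j) := by
  rw [Finset.sum_eq_single_of_mem i (Finset.mem_univ i) fun j _ hj => h j hj]
  ext j
  rcases eq_or_ne j i with rfl | hj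
  · simp
  · simp [hj, h j hj]

/-- The entries of δ drop by 1, so α can live only at the last index and β ≤ α away from the first.
The condition at the last index then removes β there too. -/
theorem reducedPairs_rev (n p q : ℕ) :
    reducedPairs (fun i : Fin (n + 1 + 1) => ((Fin.rev i : ℕ) : ℤ)) p q =
      {(Pi.single (Fin.last (n + 1)) q, Pi.single 0 p)} := by
  have h0 : (0 : Fin (n + 1 + 1)) < Fin.last (n + 1) := Fin.last_pos
  ext ⟨α, β⟩
  rw [reducedPairs, Finset.mem_filter, mem_pieriPairs, Finset.mem_singleton, Prod.mk.injEq]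
  simp only [Fin.val_rev]
  constructor
  · rintro ⟨⟨⟨rfl, rfl⟩, h⟩, h'⟩
    have hα : ∀ i : Fin (n + 1), α i.castSucc = 0 := by
      intro i
      have := (h _ _ i.castSucc_lt_succ).1
      simp only [Fin.val_castSucc, Fin.val_succ] at this
      omega
    have hβ : ∀ i : Fin (n + 1), β i.succ ≤ α i.succ := by
      intro i
      have := (h _ _ i.castSucc_lt_succ).2
      rw [hα] at this
      simp only [Fin.val_castSucc, Fin.val_succ] at this
      omega
    refine ⟨eq_piSingle_of_forall_ne _ fun j hj => ?_, eq_piSingle_of_forall_ne _ fun j hj => ?_⟩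
    · obtain ⟨i, rfl⟩ := Fin.exists_castSucc_eq.2 hj
      exact hα i
    · obtain ⟨i, rfl⟩ := Fin.exists_succ_eq.2 hj
      have h1 := hβ i
      rcases eq_or_ne i.succ (Fin.last (n + 1)) with hi | hi
      · rw [hi] at h1 ⊢
        omega
      · obtain ⟨j, hj'⟩ := Fin.exists_castSucc_eq.2 hi
        have := hα j
        rw [hj'] at this
        omega
  · rintro ⟨rfl, rfl⟩
    refine ⟨⟨by simp, fun i j hij => ?_⟩, Or.inr (Pi.single_eq_of_ne h0.ne' _)⟩
    rw [Pi.single_eq_of_ne (hij.trans_le (Fin.le_last j)).ne,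
      Pi.single_eq_of_ne (Fin.ne_zero_of_lt hij)]
    have : (i : ℕ) < j := hij
    omega

/-! ### Schur polynomials: a near-rectangle times any partition -/

section

variable {n : ℕ}

/-- The variables as elements of the field of rational functions. -/
noncomputable def ratVar (n : ℕ) (i : Fin n) : FractionRing (MvPolynomial (Fin n) ℤ) :=
  algebraMap (MvPolynomial (Fin n) ℤ) _ (MvPolynomial.X i)

theorem ratVar_ne_zero (i : Fin n) : ratVar n i ≠ 0 := by
  rw [ratVar, Ne, FaithfulSMul.algebraMap_eq_zero_iff]
  exact MvPolynomial.X_ne_zero i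

theorem algebraMap_alternant (p : Fin n → ℕ) :
    algebraMap (MvPolynomial (Fin n) ℤ) (FractionRing (MvPolynomial (Fin n) ℤ)) (alternant p) =
      zAlternant (ratVar n) fun i => p i + (Fin.rev i : ℕ) := by
  rw [alternant, zAlternant, RingHom.map_det]
  congr 1
  ext i j
  simp only [RingHom.mapMatrix_apply, Matrix.map_apply, Matrix.of_apply, map_pow, ratVar]
  rw [← zpow_natCast]
  push_cast
  rfl

theorem schur_eq_div (p : PartitionsLE n) :
    schur p = zAlternant (ratVar n) (fun i => p.1 i + (Fin.rev i : ℕ)) /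
      zAlternant (ratVar n) fun i => ((Fin.rev i : ℕ) : ℤ) := by
  rw [schur, algebraMap_alternant, algebraMap_alternant]
  simp

theorem zAlternant_rev_ne_zero (n : ℕ) :
    zAlternant (ratVar n) (fun i => ((Fin.rev i : ℕ) : ℤ)) ≠ 0 := by
  have := algebraMap_alternant (0 : Fin n → ℕ)
  simp only [Pi.zero_apply, Nat.cast_zero, zero_add] at this
  rw [← this, Ne, FaithfulSMul.algebraMap_eq_zero_iff]
  exact alternant_zero_ne_zero n

theorem strictAnti_add_rev (p : PartitionsLE n) :
    StrictAnti fun i => (p.1 i : ℤ) + (Fin.rev i : ℕ) := by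
  intro i j hij
  have h1 := p.2 hij.le
  have h2 : (Fin.rev j : ℕ) < (Fin.rev i : ℕ) := Fin.rev_lt_rev.mpr hij
  simp only
  omega

/-- Multiplied by a_δ, the mixed character becomes the single alternant of δ + (p, 0, …, 0, -q);
adding q to every exponent gives λ + δ. -/
theorem schur_nearRect (l : PartitionsLE (n + 1 + 1)) {p q : ℕ}
    (hl : l.1 = nearRect (n + 1 + 1) (p + q) q 0) :
    schur l = (∏ i, ratVar _ i ^ (q : ℤ)) * mixedComplete (ratVar _) p q := by
  rw [schur_eq_div, div_eq_iff (zAlternant_rev_ne_zero _), mul_assoc,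
    mixedComplete_mul_zAlternant ratVar_ne_zero
      (by simpa using strictAnti_add_rev (⟨0, antitone_const⟩ : PartitionsLE (n + 1 + 1))),
    reducedPairs_rev, Finset.sum_singleton, ← zAlternant_add_const ratVar_ne_zero]
  congr 1
  ext i
  rw [hl, nearRect]
  simp only [Pi.single_apply, Fin.ext_iff, Fin.val_last, Fin.val_zero, Fin.val_rev]
  split_ifs <;> omega

/-- Each entry of α is at most |α| = q, so the truncated subtraction is exact and the shift by q
makes all parts nonnegative. -/
theorem antitone_of_mem_reducedPairs {m : PartitionsLE (n + 1)} {p q : ℕ}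
    {w : (Fin (n + 1) → ℕ) × (Fin (n + 1) → ℕ)}
    (hw : w ∈ reducedPairs (fun i => (m.1 i : ℤ) + (Fin.rev i : ℕ)) p q) :
    Antitone fun i => m.1 i + (q - w.1 i) + w.2 i := by
  obtain ⟨⟨h1, -⟩, h⟩ := mem_pieriPairs.1 (Finset.mem_filter.1 hw).1
  have hle : ∀ i, w.1 i ≤ q := fun i => h1 ▸ Finset.single_le_sum (fun _ _ => Nat.zero_le _)
    (Finset.mem_univ i)
  refine Fin.antitone_iff_succ_le.2 fun i => ?_
  have := (h _ _ i.castSucc_lt_succ).2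
  have h3 := hle i.castSucc
  have h4 := hle i.succ
  simp only [Fin.val_rev, Fin.val_castSucc, Fin.val_succ] at this
  omega

theorem IsSchurExpansion.lrCoeff_eq {l m : PartitionsLE n} {c : PartitionsLE n →₀ ℤ}
    (h : IsSchurExpansion l m c) (v : PartitionsLE n) : lrCoeff l m v = c v := by
  have h' : ∃ c, IsSchurExpansion l m c := ⟨c, h⟩
  rw [lrCoeff, dif_pos h', h'.choose_spec.unique h]

theorem coe_add_sub_add_of_mem_reducedPairs (m : Fin (n + 1) → ℕ) {e : Fin (n + 1) → ℤ} {p q : ℕ}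
    {w : (Fin (n + 1) → ℕ) × (Fin (n + 1) → ℕ)} (hw : w ∈ reducedPairs e p q) (i : Fin (n + 1)) :
    ((m i + (q - w.1 i) + w.2 i : ℕ) : ℤ) = m i + q - w.1 i + w.2 i := by
  obtain ⟨⟨h1, -⟩, -⟩ := mem_pieriPairs.1 (Finset.mem_filter.1 hw).1
  have : w.1 i ≤ q := h1 ▸ Finset.single_le_sum (fun _ _ => Nat.zero_le _) (Finset.mem_univ i)
  omega

theorem schur_nearRect_mul_schur (l m : PartitionsLE (n + 1 + 1)) {p q : ℕ}
    (hl : l.1 = nearRect (n + 1 + 1) (p + q) q 0) :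
    schur l * schur m =
      ∑ w ∈ (reducedPairs (fun i => (m.1 i : ℤ) + (Fin.rev i : ℕ)) p q).attach,
        schur ⟨fun i => m.1 i + (q - w.1.1 i) + w.1.2 i, antitone_of_mem_reducedPairs w.2⟩ := by
  rw [schur_nearRect l hl, schur_eq_div m, ← mul_div_assoc, mul_assoc,
    mixedComplete_mul_zAlternant ratVar_ne_zero (strictAnti_add_rev m), Finset.mul_sum,
    Finset.sum_div, ← Finset.sum_attach]
  refine Finset.sum_congr rfl fun w _ => ?_
  rw [schur_eq_div, ← zAlternant_add_const ratVar_ne_zero]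
  congr 2
  ext i
  rw [coe_add_sub_add_of_mem_reducedPairs m.1 w.2 i]
  ring

theorem isSchurExpansion_nearRect (l m : PartitionsLE (n + 1 + 1)) {p q : ℕ}
    (hl : l.1 = nearRect (n + 1 + 1) (p + q) q 0) :
    IsSchurExpansion l m
      (∑ w ∈ (reducedPairs (fun i => (m.1 i : ℤ) + (Fin.rev i : ℕ)) p q).attach,
        Finsupp.single ⟨fun i => m.1 i + (q - w.1.1 i) + w.1.2 i,
          antitone_of_mem_reducedPairs w.2⟩ 1) := by
  rw [IsSchurExpansion, schur_nearRect_mul_schur l m hl, ← Finsupp.sum_finsetSum_index]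
  · refine Finset.sum_congr rfl fun w _ => ?_
    rw [Finsupp.sum_single_index (by rw [Int.cast_zero, zero_mul]), Int.cast_one, one_mul]
  · intro r
    rw [Int.cast_zero, zero_mul]
  · intro r a b
    rw [Int.cast_add, add_mul]

/-- The Littlewood-Richardson coefficient as a number of pairs of horizontal strips, when one of
the factors is a near-rectangle. -/
theorem lrCoeff_nearRect (l m v : PartitionsLE (n + 1 + 1)) {p q : ℕ}
    (hl : l.1 = nearRect (n + 1 + 1) (p + q) q 0) :
    lrCoeff l m v = ((reducedPairs (fun i => (m.1 i : ℤ) + (Fin.rev i : ℕ)) p q).filter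
      fun w => ∀ i, (v.1 i : ℤ) = m.1 i + q - w.1 i + w.2 i).card := by
  classical
  rw [(isSchurExpansion_nearRect l m hl).lrCoeff_eq, Finsupp.finsetSum_apply, Finset.card_filter,
    Nat.cast_sum]
  conv_rhs => rw [← Finset.sum_attach]
  refine Finset.sum_congr rfl fun w _ => ?_
  have key : (⟨fun i => m.1 i + (q - w.1.1 i) + w.1.2 i, antitone_of_mem_reducedPairs w.2⟩ :
      PartitionsLE (n + 1 + 1)) = v ↔ ∀ i, (v.1 i : ℤ) = m.1 i + q - w.1.1 i + w.1.2 i := by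
    simp only [← coe_add_sub_add_of_mem_reducedPairs m.1 w.2, Nat.cast_inj]
    rw [Subtype.ext_iff, funext_iff]
    exact forall_congr' fun i => eq_comm
  by_cases h : ∀ i, (v.1 i : ℤ) = m.1 i + q - w.1.1 i + w.1.2 i
  · rw [if_pos h, key.2 h, Finsupp.single_eq_same, Nat.cast_one]
  · rw [if_neg h, Finsupp.single_eq_of_ne fun h' => h (key.1 h'.symm), Nat.cast_zero]

end

/-! ### Counting the pairs for two near-rectangles -/

/-- The strict inequalities with δ become weak ones without it: adjacent indices absorb the step 1
of δ, and monotonicity of m and v gives the rest. -/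
theorem mem_filter_reducedPairs {n : ℕ} {m v : PartitionsLE (n + 1)} {p q : ℕ}
    {w : (Fin (n + 1) → ℕ) × (Fin (n + 1) → ℕ)} :
    w ∈ (reducedPairs (fun i => (m.1 i : ℤ) + (Fin.rev i : ℕ)) p q).filter
        (fun w => ∀ i, (v.1 i : ℤ) = m.1 i + q - w.1 i + w.2 i) ↔
      ∑ i, w.1 i = q ∧ ∑ i, w.2 i = p ∧ (w.1 (Fin.last n) = 0 ∨ w.2 (Fin.last n) = 0) ∧
        (∀ i, v.1 i + w.1 i = m.1 i + q + w.2 i) ∧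
        ∀ i j, i < j → m.1 j + w.1 i ≤ m.1 i ∧ v.1 j + w.1 i ≤ m.1 i + q := by
  rw [Finset.mem_filter, reducedPairs, Finset.mem_filter, mem_pieriPairs]
  constructor
  · rintro ⟨⟨⟨⟨h1, h2⟩, h3⟩, h4⟩, h5⟩
    refine ⟨h1, h2, h4, fun i => by have := h5 i; omega, fun i j hij => ?_⟩
    obtain ⟨i, rfl⟩ := Fin.exists_castSucc_eq.2 (hij.trans_le (Fin.le_last j)).ne
    have hj : i.succ ≤ j := hij
    have hm := m.2 hj
    have hv := v.2 hj
    have h6 := h3 _ _ i.castSucc_lt_succ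
    have h7 := h5 i.succ
    simp only [Fin.val_rev, Fin.val_castSucc, Fin.val_succ] at h6
    omega
  · rintro ⟨h1, h2, h4, h5, h3⟩
    refine ⟨⟨⟨⟨h1, h2⟩, fun i j hij => ?_⟩, h4⟩, fun i => by have := h5 i; omega⟩
    have h6 := h3 i j hij
    have h7 := h5 j
    have h8 : (Fin.rev j : ℕ) < (Fin.rev i : ℕ) := Fin.rev_lt_rev.mpr hij
    omega

theorem sum_fin_add_four {k : ℕ} (f : Fin (k + 4) → ℕ) :
    ∑ i, f i = f 0 + f 1 + ∑ i : Fin k, f ⟨i + 2, by omega⟩ + f ⟨k + 2, by omega⟩ +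
      f (Fin.last (k + 3)) := by
  rw [Fin.sum_univ_castSucc, Fin.sum_univ_castSucc, Fin.sum_univ_succ, Fin.sum_univ_succ,
    ← add_assoc]
  rfl

theorem nearRect_apply (k a b z : ℕ) (i : Fin (k + 4)) : nearRect (k + 4) a b z i =
    if (i : ℕ) = 0 then a else if (i : ℕ) = k + 3 then z else b := rfl

theorem nearRectTwo_apply (k a b s y z : ℕ) (i : Fin (k + 4)) : nearRectTwo (k + 4) a b s y z i =
    if (i : ℕ) = 0 then a else if (i : ℕ) = 1 then b
    else if (i : ℕ) = k + 3 then z else if (i : ℕ) = k + 2 then y else s := rfl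

theorem nearRect_apply_of_pos (k a b z : ℕ) {i : Fin (k + 4)} (hi : 0 < (i : ℕ))
    (hi' : (i : ℕ) < k + 3) : nearRect (k + 4) a b z i = b := by
  rw [nearRect_apply, if_neg hi.ne', if_neg hi'.ne]

theorem nearRectTwo_apply_of_one_lt (k a b s y z : ℕ) {i : Fin (k + 4)} (hi : 1 < (i : ℕ))
    (hi' : (i : ℕ) < k + 2) : nearRectTwo (k + 4) a b s y z i = s := by
  rw [nearRectTwo_apply, if_neg (by omega), if_neg (by omega), if_neg (by omega),
    if_neg (by omega)]

theorem forall_fin_add_four {k : ℕ} {P : Fin (k + 4) → Prop} (h0 : P 0) (h1 : P 1)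
    (h : ∀ i : Fin (k + 4), 1 < (i : ℕ) → (i : ℕ) < k + 2 → P i) (h2 : P ⟨k + 2, by omega⟩)
    (h3 : P (Fin.last (k + 3))) (i : Fin (k + 4)) : P i := by
  by_cases c0 : (i : ℕ) = 0
  · rwa [show i = 0 from Fin.ext c0]
  by_cases c1 : (i : ℕ) = 1
  · rwa [show i = 1 from Fin.ext c1]
  by_cases c2 : (i : ℕ) = k + 2
  · rwa [show i = ⟨k + 2, by omega⟩ from Fin.ext c2]
  by_cases c3 : (i : ℕ) = k + 3
  · rwa [show i = Fin.last (k + 3) from Fin.ext c3]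
  exact h i (by omega) (by omega)

theorem sum_nearRect (k a b z : ℕ) : ∑ i, nearRect (k + 4) a b z i = a + (k + 2) * b + z := by
  rw [sum_fin_add_four, Finset.sum_congr rfl fun i _ => show _ = b from ?_, Finset.sum_const]
  · simp [nearRect_apply]
    ring
  · exact nearRect_apply_of_pos _ _ _ _ (by simp) (by simp)

theorem sum_nearRectTwo (k a b s y z : ℕ) :
    ∑ i, nearRectTwo (k + 4) a b s y z i = a + b + k * s + y + z := by
  rw [sum_fin_add_four, Finset.sum_congr rfl fun i _ => show _ = s from ?_, Finset.sum_const]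
  · simp [nearRectTwo_apply]
  · exact nearRectTwo_apply_of_one_lt _ _ _ _ _ _ (by simp) (by simp)

section

variable {k l₁ l₂ m₁ m₂ p q : ℕ} {l m v : PartitionsLE (k + 4)}
  {w : (Fin (k + 4) → ℕ) × (Fin (k + 4) → ℕ)}

theorem le_of_eq_nearRect (hl : l.1 = nearRect (k + 4) l₁ l₂ 0) : l₂ ≤ l₁ := by
  have h := l.2 (Fin.zero_le 1)
  rw [hl] at h
  simpa [nearRect] using h

theorem size_eq_of_mem_filter_reducedPairs (hl : l.1 = nearRect (k + 4) (p + q) q 0)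
    (hw : w ∈ (reducedPairs (fun i => (m.1 i : ℤ) + (Fin.rev i : ℕ)) p q).filter
      fun w => ∀ i, (v.1 i : ℤ) = m.1 i + q - w.1 i + w.2 i) :
    v.size = l.size + m.size := by
  obtain ⟨h1, h2, -, h4, -⟩ := mem_filter_reducedPairs.1 hw
  have h := Finset.sum_congr rfl fun i (_ : i ∈ Finset.univ) => h4 i
  simp only [Finset.sum_add_distrib, h1, h2, Finset.sum_const, Finset.card_univ, Fintype.card_fin,
    smul_eq_mul] at h
  rw [PartitionsLE.size, PartitionsLE.size, PartitionsLE.size, hl, sum_nearRect]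
  linarith

/-- Nothing can be removed from a row as long as a later one: here row i has the same length m₂ as
row `k + 2`. -/
theorem fst_eq_zero_of_mem_filter_reducedPairs (hm : m.1 = nearRect (k + 4) m₁ m₂ 0)
    (hw : w ∈ (reducedPairs (fun i => (m.1 i : ℤ) + (Fin.rev i : ℕ)) p q).filter
      fun w => ∀ i, (v.1 i : ℤ) = m.1 i + q - w.1 i + w.2 i)
    {i : Fin (k + 4)} (hi : 0 < (i : ℕ)) (hi' : (i : ℕ) < k + 2) : w.1 i = 0 := by
  have h := ((mem_filter_reducedPairs.1 hw).2.2.2.2 i ⟨k + 2, by omega⟩ hi').1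
  rw [hm, nearRect_apply_of_pos _ _ _ _ hi (by omega),
    nearRect_apply_of_pos _ _ _ _ (by simp) (by simp)] at h
  omega

theorem eq_nearRectTwo_of_mem_filter_reducedPairs (hm : m.1 = nearRect (k + 4) m₁ m₂ 0)
    (hw : w ∈ (reducedPairs (fun i => (m.1 i : ℤ) + (Fin.rev i : ℕ)) p q).filter
      fun w => ∀ i, (v.1 i : ℤ) = m.1 i + q - w.1 i + w.2 i) :
    ∃ v₁ v₂ v₃ v₄ : ℕ, v.1 = nearRectTwo (k + 4) v₁ v₂ (q + m₂) v₃ v₄ ∧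
      v₂ ≤ v₁ ∧ q + m₂ ≤ v₂ ∧ v₃ ≤ q + m₂ ∧ v₄ ≤ v₃ := by
  have h0 := fun i => fst_eq_zero_of_mem_filter_reducedPairs hm hw (i := i)
  obtain ⟨-, -, -, h4, h5⟩ := mem_filter_reducedPairs.1 hw
  have hge : ∀ i : Fin (k + 4), 0 < (i : ℕ) → (i : ℕ) < k + 2 → q + m₂ ≤ v.1 i := by
    intro i hi hi'
    have h := h4 i
    rw [h0 i hi hi', hm, nearRect_apply_of_pos _ _ _ _ hi (by omega)] at h
    omega
  have hle : ∀ i : Fin (k + 4), 1 < (i : ℕ) → v.1 i ≤ q + m₂ := by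
    intro i hi
    have h := (h5 1 i hi).2
    rw [hm, nearRect_apply_of_pos _ _ _ _ (by simp) (by simp)] at h
    omega
  refine ⟨v.1 0, v.1 1, v.1 ⟨k + 2, by omega⟩, v.1 (Fin.last (k + 3)), ?_, v.2 (Fin.zero_le _),
    hge 1 (by simp) (by simp), hle _ (by simp), v.2 (Fin.le_last _)⟩
  ext i
  simp only [nearRectTwo_apply]
  split_ifs with h1 h2 h3 h4
  · exact congrArg _ (Fin.ext h1)
  · exact congrArg _ (Fin.ext h2)
  · exact congrArg _ (Fin.ext h3)
  · exact congrArg _ (Fin.ext h4)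
  · exact le_antisymm (hle i (by omega)) (hge i (by omega) (by omega))

theorem sum_eq_add_add {α : Fin (k + 4) → ℕ}
    (h : ∀ i : Fin (k + 4), 0 < (i : ℕ) → (i : ℕ) < k + 2 → α i = 0) :
    ∑ i, α i = α 0 + α ⟨k + 2, by omega⟩ + α (Fin.last (k + 3)) := by
  rw [sum_fin_add_four, h 1 (by simp) (by simp), Finset.sum_eq_zero]
  · rfl
  · intro i _
    exact h _ (by simp) (by simp)

/-- The number of pairs of horizontal strips leading from one near-rectangle to `v`; a pair is
determined by the number of boxes removed from the first row. -/
theorem card_filter_reducedPairs {v₁ v₂ v₃ v₄ : ℕ} (hl : l.1 = nearRect (k + 4) (p + q) q 0)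
    (hm : m.1 = nearRect (k + 4) m₁ m₂ 0) (hv : v.1 = nearRectTwo (k + 4) v₁ v₂ (q + m₂) v₃ v₄)
    (h2 : q + m₂ ≤ v₂) (h3 : v₃ ≤ q + m₂) (h34 : v₄ ≤ v₃)
    (hsize : v.size = l.size + m.size) :
    ((reducedPairs (fun i => (m.1 i : ℤ) + (Fin.rev i : ℕ)) p q).filter
      fun w => ∀ i, (v.1 i : ℤ) = m.1 i + q - w.1 i + w.2 i).card =
    (Finset.Icc
      (max 0 (max ((q : ℤ) + m₁ - v₁) (-(m₂ : ℤ) + v₄)))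
      (min (((p + q : ℕ) : ℤ) + m₁ - v₁) (min ((q : ℤ) + m₁ - v₂)
        (min (-(q : ℤ) - m₂ + v₃ + v₄) (-(m₂ : ℤ) + v₃))))).card := by
  have hm12 := le_of_eq_nearRect hm
  have hsz : v₁ + v₂ + v₃ + v₄ = p + 3 * q + m₁ + 2 * m₂ := by
    simp only [PartitionsLE.size, hl, hm, hv, sum_nearRect, sum_nearRectTwo] at hsize
    linarith
  -- The only candidate for α with first entry a. At the last index m is 0, so v₄ + α = q + β with α
  -- or β zero gives α = q - min(q, v₄); the total q then fixes the entry at `k + 2`.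
  let A : ℕ → Fin (k + 4) → ℕ := fun a i =>
    if (i : ℕ) = 0 then a else if (i : ℕ) = k + 3 then q - min q v₄
    else if (i : ℕ) = k + 2 then min q v₄ - a else 0
  have hA0 : ∀ a, A a 0 = a := fun a => by simp [A]
  have hA1 : ∀ a, A a ⟨k + 2, by omega⟩ = min q v₄ - a := fun a => by simp [A]
  have hA2 : ∀ a, A a (Fin.last (k + 3)) = q - min q v₄ := fun a => by simp [A]
  have hA3 : ∀ a, ∀ i : Fin (k + 4), 0 < (i : ℕ) → (i : ℕ) < k + 2 → A a i = 0 := by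
    intro a i hi hi'
    simp only [A]
    split_ifs <;> omega
  let B : ℕ → Fin (k + 4) → ℕ := fun a i => v.1 i + A a i - (m.1 i + q)
  have hv0 : v.1 0 = v₁ := by simp [hv, nearRectTwo_apply]
  have hv2 : v.1 ⟨k + 2, by omega⟩ = v₃ := by simp [hv, nearRectTwo_apply]
  have hv3 : v.1 (Fin.last (k + 3)) = v₄ := by simp [hv, nearRectTwo_apply]
  have hv1 : v.1 1 = v₂ := by simp [hv, nearRectTwo_apply]
  have hm0 : m.1 0 = m₁ := by simp [hm, nearRect_apply]
  have hm1 : m.1 1 = m₂ := by simp [hm, nearRect_apply]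
  have hm2 : m.1 ⟨k + 2, by omega⟩ = m₂ := by simp [hm, nearRect_apply]
  have hm3 : m.1 (Fin.last (k + 3)) = 0 := by simp [hm, nearRect_apply]
  have hmi : ∀ i : Fin (k + 4), 0 < (i : ℕ) → (i : ℕ) < k + 3 → m.1 i = m₂ := fun i hi hi' => by
    rw [hm, nearRect_apply_of_pos _ _ _ _ hi hi']
  have hvi : ∀ i : Fin (k + 4), 1 < (i : ℕ) → (i : ℕ) < k + 2 → v.1 i = q + m₂ :=
    fun i hi hi' => by rw [hv, nearRectTwo_apply_of_one_lt _ _ _ _ _ _ hi hi']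
  refine Finset.card_bij' (fun w _ => (w.1 0 : ℤ)) (fun a _ => (A a.toNat, B a.toNat)) ?_ ?_ ?_ ?_
  · intro w hw
    have hz := fun i => fst_eq_zero_of_mem_filter_reducedPairs hm hw (i := i)
    obtain ⟨hs, hs', h0, h4, h5⟩ := mem_filter_reducedPairs.1 hw
    have hsum := hs.symm.trans (sum_eq_add_add hz)
    have hβ : w.2 0 ≤ p := hs' ▸ Finset.single_le_sum (fun _ _ => Nat.zero_le _) (Finset.mem_univ _)
    have h01 := h5 0 1 (by simp)
    have h23 := h5 ⟨k + 2, by omega⟩ (Fin.last (k + 3)) (Nat.lt_succ_self _)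
    have e0 := h4 0
    have e2 := h4 ⟨k + 2, by omega⟩
    have e3 := h4 (Fin.last (k + 3))
    -- The lower bounds are α₀ ≥ 0, β₀ ≥ 0 and the two interlacing conditions between `k + 2` and
    -- the last index, which merge into a ≥ v₄ - m₂. The upper bounds are β₀ ≤ p, v₂ + α₀ ≤ m₁ + q,
    -- and β ≥ 0 at `k + 2`, whose min(q, v₄) splits into the last two.
    simp only [Finset.mem_Icc, max_le_iff, le_min_iff]
    rcases h0 with h0 | h0 <;> omega
  · intro a ha
    simp only [Finset.mem_Icc, max_le_iff, le_min_iff] at ha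
    obtain ⟨a, rfl⟩ := Int.eq_ofNat_of_zero_le (show 0 ≤ a by omega)
    simp only [Int.toNat_natCast]
    -- The subtraction defining `B` is exact, so β is a genuine nonnegative strip.
    have hB : ∀ i, v.1 i + A a i = m.1 i + q + B a i := by
      intro i
      refine (Nat.add_sub_cancel' ?_).symm
      refine forall_fin_add_four (P := fun i => m.1 i + q ≤ v.1 i + A a i) ?_ ?_
        (fun i hi hi' => ?_) ?_ ?_ i
      · have := hA0 a
        omega
      · have := hA3 a 1 (by simp) (by simp)
        omega
      · have := hA3 a i (by omega) hi'
        have := hmi i (by omega) (by omega)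
        have := hvi i hi hi'
        omega
      · have := hA1 a
        omega
      · have := hA2 a
        omega
    have hAs : ∑ i, A a i = q := by
      rw [sum_eq_add_add (hA3 a), hA0, hA1, hA2]
      omega
    refine mem_filter_reducedPairs.2 ⟨hAs, ?_, ?_, hB, ?_⟩
    · have h := Finset.sum_congr rfl fun i (_ : i ∈ Finset.univ) => hB i
      simp only [Finset.sum_add_distrib, hAs, Finset.sum_const, Finset.card_univ, Fintype.card_fin,
        smul_eq_mul, hv, hm, sum_nearRect, sum_nearRectTwo] at h
      linarith
    · have h := hB (Fin.last (k + 3))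
      simp only [hA2, hv3, hm3] at h ⊢
      omega
    · intro i j hij
      have hij' : (i : ℕ) < j := hij
      change m.1 j + A a i ≤ m.1 i ∧ v.1 j + A a i ≤ m.1 i + q
      have hmj := m.2 hij.le
      have hvj : 1 < (j : ℕ) → v.1 j ≤ q + m₂ := fun hj => by
        rw [hv, nearRectTwo_apply]
        split_ifs <;> omega
      by_cases c0 : (i : ℕ) = 0
      · obtain rfl : i = 0 := Fin.ext c0
        have h1j : (1 : Fin (k + 4)) ≤ j := hij
        have := m.2 h1j
        have := v.2 h1j
        have := hA0 a
        omega
      by_cases c3 : (i : ℕ) < k + 2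
      · have := hA3 a i (by omega) c3
        have := hmi i (by omega) (by omega)
        omega
      · have hi : i = ⟨k + 2, by omega⟩ := Fin.ext (by simp only; omega)
        have hj : j = Fin.last (k + 3) := Fin.ext (by rw [Fin.val_last]; omega)
        rw [hi, hj]
        have := hA1 a
        omega
  · intro w hw
    have hz := fun i => fst_eq_zero_of_mem_filter_reducedPairs hm hw (i := i)
    obtain ⟨hs, hs', h0, h4, h5⟩ := mem_filter_reducedPairs.1 hw
    have hsum := hs.symm.trans (sum_eq_add_add hz)
    have e3 := h4 (Fin.last (k + 3))
    have hA : A (w.1 0) = w.1 := by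
      ext i
      simp only [A]
      split_ifs with c1 c2 c3
      · exact congrArg _ (Fin.ext c1).symm
      · rw [show i = Fin.last (k + 3) from Fin.ext c2]
        omega
      · rw [show i = ⟨k + 2, by omega⟩ from Fin.ext c3]
        rcases h0 with h0 | h0 <;> omega
      · exact (hz i (by omega) (by omega)).symm
    simp only [Int.toNat_natCast, B, hA, h4, Nat.add_sub_cancel_left]
  · intro a ha
    simp only [Finset.mem_Icc, max_le_iff, le_min_iff] at ha
    simp only [hA0]
    exact Int.toNat_of_nonneg (by omega)

end

/-! ### The formula and its independence of n -/

theorem lrCoeff_nearRect_eq_zero_of_size_ne {k l₁ l₂ : ℕ} {l m v : PartitionsLE (k + 4)}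
    (hl : l.1 = nearRect (k + 4) l₁ l₂ 0) (h : v.size ≠ l.size + m.size) : lrCoeff l m v = 0 := by
  obtain ⟨p, rfl⟩ := Nat.exists_eq_add_of_le' (le_of_eq_nearRect hl)
  rw [lrCoeff_nearRect l m v hl, Nat.cast_eq_zero, Finset.card_eq_zero,
    Finset.eq_empty_iff_forall_notMem]
  exact fun w hw => h (size_eq_of_mem_filter_reducedPairs hl hw)

theorem lrCoeff_nearRect_eq_card {k l₁ l₂ m₁ m₂ v₁ v₂ v₃ v₄ : ℕ} {l m v : PartitionsLE (k + 4)}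
    (hl : l.1 = nearRect (k + 4) l₁ l₂ 0) (hm : m.1 = nearRect (k + 4) m₁ m₂ 0)
    (hv : v.1 = nearRectTwo (k + 4) v₁ v₂ (l₂ + m₂) v₃ v₄)
    (h2 : l₂ + m₂ ≤ v₂) (h3 : v₃ ≤ l₂ + m₂) (h34 : v₄ ≤ v₃)
    (hsize : v.size = l.size + m.size) :
    lrCoeff l m v =
      ((Finset.Icc
        (max 0 (max ((l₂ : ℤ) + m₁ - v₁) (-(m₂ : ℤ) + v₄)))
        (min ((l₁ : ℤ) + m₁ - v₁) (min ((l₂ : ℤ) + m₁ - v₂)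
          (min (-(l₂ : ℤ) - m₂ + v₃ + v₄) (-(m₂ : ℤ) + v₃))))).card : ℤ) := by
  obtain ⟨p, rfl⟩ := Nat.exists_eq_add_of_le' (le_of_eq_nearRect hl)
  rw [lrCoeff_nearRect l m v hl, card_filter_reducedPairs hl hm hv h2 h3 h34 hsize]

theorem mainTheorem1 (n : ℕ) (hn : 4 ≤ n) (l₁ l₂ m₁ m₂ : ℕ) (l m : PartitionsLE n)
    (hl : l.1 = nearRect n l₁ l₂ 0) (hm : m.1 = nearRect n m₁ m₂ 0) (v : PartitionsLE n) :
    -- vanishing outside the stated shape (and size)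
    (lrCoeff l m v ≠ 0 →
      v.size = l.size + m.size ∧
      ∃ v₁ v₂ v₃ v₄ : ℕ, v.1 = nearRectTwo n v₁ v₂ (l₂ + m₂) v₃ v₄ ∧
        v₂ ≤ v₁ ∧ l₂ + m₂ ≤ v₂ ∧ v₃ ≤ l₂ + m₂ ∧ v₄ ≤ v₃) ∧
    (∀ v₁ v₂ v₃ v₄ : ℕ, v.1 = nearRectTwo n v₁ v₂ (l₂ + m₂) v₃ v₄ →
      v₂ ≤ v₁ → l₂ + m₂ ≤ v₂ → v₃ ≤ l₂ + m₂ → v₄ ≤ v₃ →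
      -- the formula
      (v.size = l.size + m.size →
        lrCoeff l m v =
          ((Finset.Icc
            (max 0 (max ((l₂ : ℤ) + m₁ - v₁) (-(m₂ : ℤ) + v₄)))
            (min ((l₁ : ℤ) + m₁ - v₁) (min ((l₂ : ℤ) + m₁ - v₂)
              (min (-(l₂ : ℤ) - m₂ + v₃ + v₄) (-(m₂ : ℤ) + v₃))))).card : ℤ)) ∧
      -- independence of `n`: the value is the one for `n = 4`
      (∀ l' m' v' : PartitionsLE 4, l'.1 = nearRect 4 l₁ l₂ 0 → m'.1 = nearRect 4 m₁ m₂ 0 →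
        v'.1 = nearRectTwo 4 v₁ v₂ (l₂ + m₂) v₃ v₄ →
        lrCoeff l m v = lrCoeff l' m' v')) := by
  obtain ⟨k, rfl⟩ := Nat.exists_eq_add_of_le' hn
  refine ⟨fun h => ?_, fun v₁ v₂ v₃ v₄ hv _ h2 h3 h34 =>
    ⟨lrCoeff_nearRect_eq_card hl hm hv h2 h3 h34, fun l' m' v' hl' hm' hv' => ?_⟩⟩
  · obtain ⟨p, rfl⟩ := Nat.exists_eq_add_of_le' (le_of_eq_nearRect hl)
    rw [lrCoeff_nearRect l m v hl, Nat.cast_ne_zero, Finset.card_ne_zero] at h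
    obtain ⟨w, hw⟩ := h
    exact ⟨size_eq_of_mem_filter_reducedPairs hl hw,
      eq_nearRectTwo_of_mem_filter_reducedPairs hm hw⟩
  -- The n-4 middle rows contribute k(l₂ + m₂) to both sides, so the size condition is the same for
  -- n = 4.
  · have hsize : v.size = l.size + m.size ↔ v'.size = l'.size + m'.size := by
      simp only [PartitionsLE.size, hl, hm, hv, hl', hm', hv', sum_nearRect, sum_nearRectTwo,
        show ∀ a b z, ∑ i, nearRect 4 a b z i = a + (0 + 2) * b + z from sum_nearRect 0,
        show ∀ a b s y z, ∑ i, nearRectTwo 4 a b s y z i = a + b + 0 * s + y + z from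
          sum_nearRectTwo 0]
      constructor <;> intro h <;> linarith
    by_cases h : v.size = l.size + m.size
    · rw [lrCoeff_nearRect_eq_card hl hm hv h2 h3 h34 h,
        lrCoeff_nearRect_eq_card (k := 0) hl' hm' hv' h2 h3 h34 (hsize.1 h)]
    · rw [lrCoeff_nearRect_eq_zero_of_size_ne hl h,
        lrCoeff_nearRect_eq_zero_of_size_ne (k := 0) hl' fun h' => h (hsize.2 h')]
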